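/- Let $N=\mathbb Z^d$, $M=\operatorname{Hom}_{\mathbb Z}(N,\mathbb Z)$, and let $\triangle$ be a complete regular fan in $N_{\mathbb R}$ (every cone is generated by part of a $\mathbb Z$-basis of $N$, and the cones cover $N_{\mathbb R}$) whose associated smooth complete split toric variety $X$ over $\mathbb Q$ is projective and has globally generated anticanonical bundle $-K_X=\mathcal O_X(D_0)$, where $D_0=\sum_{\varrho\in\triangle(1)}D_\varrho$ is the sum of the boundary divisors. Let $r=\operatorname{rank}\operatorname{Pic}(X)$, so that $\triangle$ has $n=r+d$ rays $\varrho$, with primitive generators $n_\varrho\in N$. For a maximal cone $\sigma\in\triangle_{\max}$ with set of rays $\sigma(1)$, let $(n_\varrho^\vee)_{\varrho\in\sigma(1)}$ be the basis of $M$ dual to the basis $(n_\varrho)_{\varrho\in\sigma(1)}$ of $N$, let $m_{D_0}(\sigma)\in M$ be the element with $\langle m_{D_0}(\sigma),n_\varrho\rangle=1$ for all $\varrho\in\sigma(1)$, and put $$D_0(\sigma)=\sum_{\varrho\in\triangle(1)}\bigl(1-\langle m_{D_0}(\sigma),n_\varrho\rangle\bigr)D_\varrho,\qquad E_\sigma(\varrho')=D_{\varrho'}-\sum_{\varrho\in\triangle(1)}\langle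 n_{\varrho'}^\vee,n_\varrho\rangle D_\varrho\quad(\varrho'\in\sigma(1)).$$ For a tuple $\mathbf X=(X_\varrho)_{\varrho\in\triangle(1)}$ of positive integers and a divisor $D=\sum_\varrho a_\varrho D_\varrho$ write $\mathbf X^D=\prod_\varrho X_\varrho^{a_\varrho}$. For real numbers $B\ge 3$ and $A>0$ let $$\mathcal A(B)=\Bigl\{\mathbf X\in\mathbb Z_{>0}^{\,r+d}:\ \max_{\sigma\in\triangle_{\max}}\mathbf X^{D_0(\sigma)}\le B\Bigr\},$$ $$\mathcal A^{(A)\flat}(B)=\bigl\{\mathbf X\in\mathcal A(B):\ \mathbf X^{E_\sigma(\varrho')}\ge(\log B)^A\ \text{ for all }\sigma\in\triangle_{\max},\ \varrho'\in\sigma(1)\bigr\}.$$ Then for every $A>0$ there is a constant $C$, depending only on $A$ and $\triangle$, such that for all $B\ge 3$ the set $\mathcal A(B)\setminus\mathcal A^{(A)\flat}(B)$ is finite and $$\#\bigl(\mathcal A(B)\setminus\mathcal A^{(A)\flat}(B)\bigr)\le C\,B(\log B)^{r-2}\log\log B.$$ -/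

import Mathlib

/-! Smooth complete toric varieties are encoded by their fans. The lattice is `N = ℤ^d`,
`M` is its dual, and the rays of the fan are indexed by `Fin n`. -/

noncomputable section

namespace ToricCount

open scoped BigOperators

/-- The lattice `N = ℤ^d`. -/
abbrev N (d : ℕ) : Type := Fin d → ℤ

/-- The dual lattice `M = Hom(N, ℤ)`, i.e. the character lattice of the torus. -/
abbrev M (d : ℕ) : Type := Module.Dual ℤ (N d)

/-- A lattice vector regarded in `N_ℝ = ℝ^d`. -/
def toReal {d : ℕ} (v : N d) : Fin d → ℝ := fun k => (v k : ℝ)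

/-- The convex cone in `N_ℝ` generated by the vectors `u i`, `i ∈ σ`. -/
def coneOf {d n : ℕ} (u : Fin n → N d) (σ : Finset (Fin n)) : Set (Fin d → ℝ) :=
  {x | ∃ c : Fin n → ℝ, (∀ i, 0 ≤ c i) ∧ x = ∑ i ∈ σ, c i • toReal (u i)}

/-- A complete regular fan in `N_ℝ = ℝ^d` with exactly `n` rays. The ray with index `i` is spanned
by its primitive vector `gen i`. As regular cones are simplicial, a cone is determined by the set
of its rays, and its faces are the cones spanned by the subsets of this set; so the fan is given
by the family `cones` of the ray sets `σ(1)` of its cones. -/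
structure CompleteRegularFan (d n : ℕ) where
  /-- the primitive generators `n_ϱ` of the rays -/
  gen : Fin n → N d
  /-- the sets `σ(1)`, for the cones `σ` of the fan -/
  cones : Set (Finset (Fin n))
  /-- the cone `{0}` belongs to the fan -/
  zero_mem : ∅ ∈ cones
  /-- every index is the index of a ray of the fan -/
  ray_mem : ∀ i, {i} ∈ cones
  /-- every face of a cone of the fan belongs to the fan -/
  face_mem : ∀ σ ∈ cones, ∀ τ ⊆ σ, τ ∈ cones
  /-- every cone is generated by a part of a `ℤ`-basis of the lattice -/
  regular : ∀ σ ∈ cones, ∃ (b : Module.Basis (Fin d) ℤ (N d)) (e : σ ↪ Fin d),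
    ∀ i : σ, b (e i) = gen i
  /-- two cones intersect in their common face -/
  inter : ∀ σ ∈ cones, ∀ τ ∈ cones, coneOf gen σ ∩ coneOf gen τ = coneOf gen (σ ∩ τ)
  /-- the support of the fan is the whole space -/
  complete : (⋃ σ ∈ cones, coneOf gen σ) = Set.univ

namespace CompleteRegularFan

variable {d n : ℕ} (Δ : CompleteRegularFan d n)

/-- The type of maximal cones: since generators of a cone are linearly independent, the real span
of a cone has dimension `d` if and only if the cone has `d` rays. -/
def MaxCone : Type := {σ : Finset (Fin n) // σ ∈ Δ.cones ∧ σ.card = d}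

variable {Δ}

theorem MaxCone.linearIndependent (σ : Δ.MaxCone) :
    LinearIndependent ℤ (fun i : σ.1 => Δ.gen i) := by
  obtain ⟨b, e, h⟩ := Δ.regular σ.1 σ.2.1
  have h1 : (fun i : σ.1 => Δ.gen i) = b ∘ e := by
    funext i
    exact (h i).symm
  rw [h1]
  exact b.linearIndependent.comp e e.injective

theorem MaxCone.span_eq_top (σ : Δ.MaxCone) :
    ⊤ ≤ Submodule.span ℤ (Set.range (fun i : σ.1 => Δ.gen i)) := by
  obtain ⟨b, e, h⟩ := Δ.regular σ.1 σ.2.1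
  have h1 : (fun i : σ.1 => Δ.gen i) = b ∘ e := by
    funext i
    exact (h i).symm
  have h2 : Function.Surjective e := by
    have hb : Function.Bijective e := by
      rw [Fintype.bijective_iff_injective_and_card]
      exact ⟨e.injective, by simp [σ.2.2]⟩
    exact hb.2
  rw [h1, h2.range_comp, b.span_eq]

/-- The basis `(n_ϱ)`, `ϱ ∈ σ(1)`, of `N` attached to a maximal cone `σ`. -/
def MaxCone.basis (σ : Δ.MaxCone) : Module.Basis σ.1 ℤ (N d) :=
  Module.Basis.mk σ.linearIndependent σ.span_eq_top

/-- The element `n_ϱ^∨` of `M`, for `ϱ ∈ σ(1)`, of the basis dual to `(n_ϱ)`, `ϱ ∈ σ(1)`. -/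
def MaxCone.dualVec (σ : Δ.MaxCone) (j : σ.1) : M d := σ.basis.coord j

/-- The element `m_{D_0}(σ)` of `M`: its value is `1` on `n_ϱ` for all `ϱ ∈ σ(1)`. -/
def MaxCone.m (σ : Δ.MaxCone) : M d := σ.basis.constr ℤ (fun _ => (1 : ℤ))

variable (Δ)

/-- The homomorphism `h : M → ℤ^{Δ(1)}`, `m ↦ ∑_ϱ ⟨m, n_ϱ⟩ D_ϱ` (the divisor of a character). A
torus invariant divisor `∑_ϱ a_ϱ D_ϱ` is written as the function `ϱ ↦ a_ϱ`. -/
def divHom : M d →ₗ[ℤ] (Fin n → ℤ) := LinearMap.pi (fun i => Module.Dual.eval ℤ (N d) (Δ.gen i))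

/-- The Picard group of the toric variety, as the cokernel of `h`. -/
abbrev Pic : Type := (Fin n → ℤ) ⧸ LinearMap.range Δ.divHom

/-- The Picard number `r`. -/
def picRank : ℕ := Module.finrank ℤ Δ.Pic

/-- The sections of the sheaf `𝒪(D)` over `⋃ U_{{ϱ}}`, `ϱ ∈ S`, inside the group algebra
`ℚ[M] = 𝒪(T)` of the open torus: they are spanned by the characters `χ^m` with
`⟨m, n_ϱ⟩ ≥ -D_ϱ` for all `ϱ ∈ S`. For `S = σ(1)` these are the sections over the affine chart
`U_σ`, and if moreover `D = 0` one gets its coordinate ring `ℚ[σ^∨ ∩ M]`; if `S` consists of all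
rays, these are the global sections. -/
def sections (D : Fin n → ℤ) (S : Finset (Fin n)) : Submodule ℚ (AddMonoidAlgebra ℚ (M d)) :=
  Submodule.span ℚ
    ((fun m : M d => AddMonoidAlgebra.single m (1 : ℚ)) '' {m | ∀ i ∈ S, -D i ≤ m (Δ.gen i)})

/-- The sheaf `𝒪(D)` is globally generated: over each chart `U_σ`, every section is a combination
of global sections with coefficients in the coordinate ring of `U_σ`. -/
def GloballyGenerated (D : Fin n → ℤ) : Prop :=
  ∀ σ ∈ Δ.cones, Δ.sections D σ ≤ Δ.sections 0 σ * Δ.sections D Finset.univ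

/-- The toric variety is projective: some torus invariant divisor `D` is ample, i.e. has a strictly
convex support function. -/
def Projective : Prop :=
  ∃ D : Fin n → ℤ, ∀ σ : Δ.MaxCone, ∃ m : M d,
    (∀ i ∈ σ.1, m (Δ.gen i) = -D i) ∧ (∀ i, i ∉ σ.1 → -D i < m (Δ.gen i))

/-- The anticanonical divisor `D_0 = ∑_ϱ D_ϱ`. -/
def D₀ (n : ℕ) : Fin n → ℤ := fun _ => 1

variable {Δ}

/-- `D_0(σ) = D_0 + ∑_ϱ ⟨-m_{D_0}(σ), n_ϱ⟩ D_ϱ`. -/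
def MaxCone.D (σ : Δ.MaxCone) : Fin n → ℤ := D₀ n + Δ.divHom (-σ.m)

/-- `F_σ(j) = ∑_ϱ ⟨n_{ϱ_j}^∨, n_ϱ⟩ D_ϱ`, for a ray `ϱ_j` in `σ(1)`. -/
def MaxCone.F (σ : Δ.MaxCone) (j : σ.1) : Fin n → ℤ := Δ.divHom (σ.dualVec j)

/-- `E_σ(j) = D_{ϱ_j} - F_σ(j)`, for a ray `ϱ_j` in `σ(1)`. -/
def MaxCone.E (σ : Δ.MaxCone) (j : σ.1) : Fin n → ℤ := Pi.single (j : Fin n) 1 - σ.F j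

/-- The Laurent monomial `X^D = ∏_ϱ X_ϱ ^ D_ϱ`, for a divisor `D = ∑_ϱ D_ϱ D_ϱ`. -/
def monomial {n : ℕ} (X : Fin n → ℕ) (D : Fin n → ℤ) : ℝ := ∏ i, (X i : ℝ) ^ D i

variable (Δ)

/-- `𝒜(B)`: the tuples of positive integers with `max_σ X^{D_0(σ)} ≤ B`, where `σ` runs over the
maximal cones. -/
def setA (B : ℝ) : Set (Fin n → ℕ) :=
  {X | (∀ i, 0 < X i) ∧ ∀ σ : Δ.MaxCone, monomial X σ.D ≤ B}

/-- `𝒜^{(A)♭}(B)`: the tuples in `𝒜(B)` with `X^{E_σ(j)} ≥ (log B)^A` for all maximal cones `σ` and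
all rays `ϱ_j` of `σ`. -/
def setAFlat (A B : ℝ) : Set (Fin n → ℕ) :=
  {X | X ∈ Δ.setA B ∧ ∀ (σ : Δ.MaxCone) (j : σ.1), Real.log B ^ A ≤ monomial X (σ.E j)}

end CompleteRegularFan

end ToricCount

end

/-!
Write `x = log₂ X ∈ ℝ^n`, `L = log₂ B` and `y = ∑ x_ϱ n_ϱ ∈ N_ℝ`. The maximal cones cover `N_ℝ`,
so `-y = ∑ c_ϱ n_ϱ` with `c ≥ 0` for the rays of some maximal cone `σ`, and the height condition at
this `σ` says `∑ x_ϱ + ∑ c_ϱ ≤ L` (`abs_sum_logb_le`). Hence `∑ x_ϱ ≤ L`, and `y` has size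
`O(L - ∑ x_ϱ)`: a point with `∏ X_ϱ` close to `B` has `y` close to `0`. The monomial `X^{E_σ(j)}`
has logarithm `x_j` minus a linear form in `y`, so if it is at most `(log B)^A`, then
`x_j = O(log log B + L - ∑ x_ϱ)` (`exists_dyadic_mem_boxes`).

Now cut `ℤ_{>0}^n` into dyadic boxes `k`, of cardinality `2^{∑ k}`, and sort them by the defect
`t = ⌊L⌋ - ∑ k`. The factor `2^{-t}` beats every polynomial loss in `t` (`ncard_le_of_dyadic`), so
it suffices to find `O((log B)^{r-2} (log log B) (t+1)^q)` boxes for each `t`. Take a maximal cone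
`σ` without the ray `j`, and consider the coefficients of `D_0(σ)` at the rays outside
`σ(1) ∪ {j}`.

* If one of them is nonzero, then `∑ k`, `k_j` and the `d` coordinates of `∑ k_ϱ n_ϱ` are
  independent, and `n - d - 2 = r - 2` entries of `k` remain free (`card_boxes_le`).
* If all vanish, then `∑ k` is a combination of `k_j` and `∑ k_ϱ n_ϱ`, which forces
  `L = O(log log B + t)` (`le_of_mem_boxes`); multiplying the trivial bound by a high power of
  `(log log B) (t+1) / L` gives the claim.
-/

noncomputable section
namespace ToricCount
namespace CompleteRegularFan

open scoped BigOperators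

/-! ### Maximal cones -/

/-- The extension of a character `φ` of the torus to a linear form on `N_ℝ`. -/
def realDual {d : ℕ} (φ : M d) : (Fin d → ℝ) →ₗ[ℝ] ℝ :=
  ∑ a, (φ (Pi.single a 1) : ℝ) • LinearMap.proj a

theorem dual_apply_eq_sum {d : ℕ} (φ : M d) (v : N d) :
    φ v = ∑ a, v a * φ (Pi.single a 1) := by
  rw [LinearMap.pi_apply_eq_sum_univ φ v]
  refine Finset.sum_congr rfl fun a _ => ?_
  rw [smul_eq_mul]
  congr 2
  funext b
  simp [Pi.single_apply, eq_comm]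

theorem realDual_toReal {d : ℕ} (φ : M d) (v : N d) : realDual φ (toReal v) = φ v := by
  rw [dual_apply_eq_sum φ v]
  simp [realDual, toReal, mul_comm]

variable {d n : ℕ} {Δ : CompleteRegularFan d n}

instance : Finite Δ.MaxCone := by
  unfold MaxCone
  infer_instance

theorem MaxCone.dualVec_gen (σ : Δ.MaxCone) (i j : σ.1) :
    σ.dualVec j (Δ.gen i) = if i = j then 1 else 0 := by
  have h : σ.basis i = Δ.gen i := by simp [MaxCone.basis]
  rw [MaxCone.dualVec, ← h, Module.Basis.coord_apply, Module.Basis.repr_self,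
    Finsupp.single_apply]

theorem MaxCone.m_gen (σ : Δ.MaxCone) {i : Fin n} (hi : i ∈ σ.1) : σ.m (Δ.gen i) = 1 := by
  have h : σ.basis ⟨i, hi⟩ = Δ.gen i := by simp [MaxCone.basis]
  rw [MaxCone.m, ← h, Module.Basis.constr_basis]

theorem MaxCone.sum_dualVec_smul (σ : Δ.MaxCone) (v : N d) :
    ∑ j : σ.1, σ.dualVec j v • Δ.gen j = v := by
  conv_rhs => rw [← σ.basis.sum_repr v]
  simp [MaxCone.dualVec, MaxCone.basis]

/-- The cone of a maximal cone is cut out by its dual basis. -/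
theorem MaxCone.mem_coneOf_iff (σ : Δ.MaxCone) (x : Fin d → ℝ) :
    x ∈ coneOf Δ.gen σ.1 ↔ ∀ j : σ.1, 0 ≤ realDual (σ.dualVec j) x := by
  constructor
  · rintro ⟨c, hc, rfl⟩ j
    rw [map_sum, ← Finset.sum_coe_sort]
    simp only [map_smul, realDual_toReal, σ.dualVec_gen]
    simpa using hc j
  · intro h
    refine ⟨fun i => if hi : i ∈ σ.1 then realDual (σ.dualVec ⟨i, hi⟩) x else 0, ?_, ?_⟩
    · intro i
      by_cases hi : i ∈ σ.1
      · simpa [hi] using h ⟨i, hi⟩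
      · simp [hi]
    · have key : ∀ b : Fin d, x b = ∑ j : σ.1, realDual (σ.dualVec j) x * (Δ.gen j b : ℝ) := by
        intro b
        have h1 : ∀ a : Fin d,
            ∑ j : σ.1, (σ.dualVec j (Pi.single a 1) : ℝ) * (Δ.gen j b : ℝ) =
              if b = a then 1 else 0 := by
          intro a
          have := congrFun (σ.sum_dualVec_smul (Pi.single a 1)) b
          rw [Finset.sum_apply] at this
          have h2 := congrArg (Int.cast : ℤ → ℝ) this
          simpa [Pi.single_apply] using h2
        calc x b = ∑ a, x a * (if b = a then 1 else 0) := by simp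
          _ = ∑ a, x a * ∑ j : σ.1, (σ.dualVec j (Pi.single a 1) : ℝ) * (Δ.gen j b : ℝ) := by
              simp_rw [h1]
          _ = _ := by
              simp_rw [Finset.mul_sum]
              rw [Finset.sum_comm]
              refine Finset.sum_congr rfl fun j _ => ?_
              simp only [realDual, LinearMap.sum_apply, LinearMap.smul_apply, LinearMap.proj_apply,
                smul_eq_mul, Finset.sum_mul]
              exact Finset.sum_congr rfl fun a _ => by ring
      rw [← Finset.sum_coe_sort]
      funext b
      rw [key b, Finset.sum_apply]
      simp [toReal]

theorem MaxCone.isClosed_coneOf (σ : Δ.MaxCone) : IsClosed (coneOf Δ.gen σ.1) := by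
  have h : coneOf Δ.gen σ.1 = ⋂ j : σ.1, {x | 0 ≤ realDual (σ.dualVec j) x} := by
    ext x
    simp [σ.mem_coneOf_iff]
  rw [h]
  exact isClosed_iInter fun j =>
    isClosed_le continuous_const (LinearMap.continuous_of_finiteDimensional _)

/-- The maximal cones already cover `N_ℝ`: their union is closed, and its complement lies in the
union of finitely many proper subspaces, which has measure zero. -/
theorem exists_maxCone_mem (Δ : CompleteRegularFan d n) (x : Fin d → ℝ) :
    ∃ σ : Δ.MaxCone, x ∈ coneOf Δ.gen σ.1 := by
  have hclosed : IsClosed (⋃ σ : Δ.MaxCone, coneOf Δ.gen σ.1) :=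
    isClosed_iUnion_of_finite fun σ => σ.isClosed_coneOf
  have hnull : ∀ τ : Finset (Fin n), τ.card < d →
      MeasureTheory.volume (coneOf Δ.gen τ) = 0 := by
    intro τ hτ
    set V := Submodule.span ℝ ((τ.image fun i => toReal (Δ.gen i) : Finset _) : Set (Fin d → ℝ))
    have hV : V ≠ ⊤ := by
      intro hV
      have h1 : Module.finrank ℝ V ≤ τ.card :=
        (finrank_span_finset_le_card _).trans Finset.card_image_le
      rw [hV, finrank_top, Module.finrank_fin_fun] at h1
      omega
    have hsub : coneOf Δ.gen τ ⊆ (V : Set (Fin d → ℝ)) := by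
      rintro _ ⟨c, -, rfl⟩
      exact V.sum_mem fun i hi => V.smul_mem _ (Submodule.subset_span
        (Finset.mem_coe.2 (Finset.mem_image_of_mem _ hi)))
    exact MeasureTheory.measure_mono_null hsub
      (MeasureTheory.Measure.addHaar_submodule MeasureTheory.volume V hV)
  have hdense : Dense (⋃ σ : Δ.MaxCone, coneOf Δ.gen σ.1) := by
    refine MeasureTheory.Measure.dense_of_ae (μ := MeasureTheory.volume) ?_
    have h2 : ∀ᵐ z : Fin d → ℝ, ∀ τ : {τ : Finset (Fin n) // τ.card < d},
        z ∉ coneOf Δ.gen τ.1 := by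
      rw [MeasureTheory.ae_all_iff]
      intro τ
      exact MeasureTheory.measure_eq_zero_iff_ae_notMem.1 (hnull τ.1 τ.2)
    filter_upwards [h2] with z hz
    have hz' : z ∈ ⋃ σ ∈ Δ.cones, coneOf Δ.gen σ := Δ.complete ▸ Set.mem_univ z
    change z ∈ ⋃ σ : Δ.MaxCone, coneOf Δ.gen σ.1
    simp only [Set.mem_iUnion] at hz' ⊢
    obtain ⟨σ, hσ, hzσ⟩ := hz'
    obtain ⟨-, e, -⟩ := Δ.regular σ hσ
    have hle : σ.card ≤ d := by simpa using Fintype.card_le_of_embedding e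
    refine ⟨⟨σ, hσ, le_antisymm hle ?_⟩, hzσ⟩
    by_contra hlt
    exact hz ⟨σ, by omega⟩ hzσ
  have huniv : x ∈ ⋃ σ : Δ.MaxCone, coneOf Δ.gen σ.1 := by
    rw [← hclosed.closure_eq, hdense.closure_eq]
    trivial
  simpa using huniv

/-- A maximal cone containing `-n_ϱ` does not have `ϱ` as a ray. -/
theorem exists_maxCone_notMem (Δ : CompleteRegularFan d n) (j : Fin n) :
    ∃ σ : Δ.MaxCone, j ∉ σ.1 := by
  obtain ⟨σ, hσ⟩ := Δ.exists_maxCone_mem (-toReal (Δ.gen j))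
  refine ⟨σ, fun hj => ?_⟩
  have h := (σ.mem_coneOf_iff _).1 hσ ⟨j, hj⟩
  rw [map_neg, realDual_toReal, σ.dualVec_gen ⟨j, hj⟩ ⟨j, hj⟩] at h
  norm_num at h

theorem divHom_injective (Δ : CompleteRegularFan d n) : Function.Injective Δ.divHom := by
  rw [injective_iff_map_eq_zero]
  intro φ hφ
  obtain ⟨σ, -⟩ := Δ.exists_maxCone_mem 0
  refine σ.basis.ext fun i => ?_
  have h := congrFun hφ i
  simpa [MaxCone.basis, divHom] using h

theorem picRank_add (Δ : CompleteRegularFan d n) : Δ.picRank + d = n := by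
  have h := Submodule.finrank_quotient_add_finrank (LinearMap.range Δ.divHom)
  rw [LinearMap.finrank_range_of_inj Δ.divHom_injective] at h
  simpa [picRank, Module.finrank_linearMap] using h

/-! ### The height condition in logarithmic coordinates -/

theorem logb_monomial {X : Fin n → ℕ} (hX : ∀ i, 0 < X i) (D : Fin n → ℤ) :
    Real.logb 2 (monomial X D) = ∑ i, (D i : ℝ) * Real.logb 2 (X i) := by
  have h : ∀ i, (X i : ℝ) ≠ 0 := fun i => by exact_mod_cast (hX i).ne'
  rw [monomial, Real.logb_prod _ _ fun i _ => zpow_ne_zero _ (h i)]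
  exact Finset.sum_congr rfl fun i _ => by
    rw [Real.logb, Real.log_zpow, Real.logb, mul_div_assoc]

theorem monomial_pos {X : Fin n → ℕ} (hX : ∀ i, 0 < X i) (D : Fin n → ℤ) : 0 < monomial X D :=
  Finset.prod_pos fun i _ => zpow_pos (by exact_mod_cast hX i) _

/-- The sum of the absolute values of a character on the rays. -/
def rayNorm (Δ : CompleteRegularFan d n) (φ : M d) : ℝ := ∑ i, |(φ (Δ.gen i) : ℝ)|

theorem rayNorm_nonneg (Δ : CompleteRegularFan d n) (φ : M d) : 0 ≤ Δ.rayNorm φ :=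
  Finset.sum_nonneg fun _ _ => abs_nonneg _

theorem abs_le_rayNorm (Δ : CompleteRegularFan d n) (φ : M d) (i : Fin n) :
    |(φ (Δ.gen i) : ℝ)| ≤ Δ.rayNorm φ :=
  Finset.single_le_sum (f := fun i => |(φ (Δ.gen i) : ℝ)|) (fun _ _ => abs_nonneg _)
    (Finset.mem_univ i)

/-- With `x = log₂ X` and `y = ∑ x_ϱ n_ϱ`, the height condition at a maximal cone `σ` containing
`-y = ∑ c_ϱ n_ϱ` reads `∑ x_ϱ + ∑ c_ϱ ≤ log₂ B`. So the size of `y` is controlled by the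
gap between `∑ x_ϱ` and `log₂ B`. -/
theorem abs_sum_logb_le {B : ℝ} {X : Fin n → ℕ} (hX : X ∈ Δ.setA B) :
    ∑ i, Real.logb 2 (X i) ≤ Real.logb 2 B ∧
    ∀ φ : M d, |∑ i, Real.logb 2 (X i) * (φ (Δ.gen i) : ℝ)| ≤
      Δ.rayNorm φ * (Real.logb 2 B - ∑ i, Real.logb 2 (X i)) := by
  obtain ⟨hpos, hB⟩ := hX
  set x : Fin n → ℝ := fun i => Real.logb 2 (X i) with hx
  obtain ⟨σ, c, hc, hy⟩ := Δ.exists_maxCone_mem (-∑ i, x i • toReal (Δ.gen i))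
  have hφ : ∀ φ : M d, -∑ i, x i * (φ (Δ.gen i) : ℝ) = ∑ i ∈ σ.1, c i * (φ (Δ.gen i) : ℝ) := by
    intro φ
    have h := congrArg (realDual φ) hy
    simpa [map_sum, realDual_toReal] using h
  have hsum : ∑ i, x i + ∑ i ∈ σ.1, c i ≤ Real.logb 2 B := by
    have h1 : Real.logb 2 (monomial X σ.D) ≤ Real.logb 2 B :=
      Real.logb_le_logb_of_le (by norm_num) (monomial_pos hpos _) (hB σ)
    have h2 : Real.logb 2 (monomial X σ.D) = ∑ i, x i + -∑ i, x i * (σ.m (Δ.gen i) : ℝ) := by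
      rw [logb_monomial hpos, ← Finset.sum_neg_distrib, ← Finset.sum_add_distrib]
      refine Finset.sum_congr rfl fun i _ => ?_
      simp [MaxCone.D, D₀, divHom, hx]
      ring
    rw [h2, hφ] at h1
    refine le_trans (le_of_eq ?_) h1
    congr 1
    exact Finset.sum_congr rfl fun i hi => by simp [σ.m_gen hi]
  have hc0 : 0 ≤ ∑ i ∈ σ.1, c i := Finset.sum_nonneg fun i _ => hc i
  refine ⟨by linarith, fun φ => ?_⟩
  rw [← abs_neg, hφ]
  calc |∑ i ∈ σ.1, c i * (φ (Δ.gen i) : ℝ)| ≤ ∑ i ∈ σ.1, |c i * (φ (Δ.gen i) : ℝ)| :=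
        Finset.abs_sum_le_sum_abs _ _
    _ ≤ ∑ i ∈ σ.1, Δ.rayNorm φ * c i := by
        refine Finset.sum_le_sum fun i _ => ?_
        rw [abs_mul, abs_of_nonneg (hc i), mul_comm]
        exact mul_le_mul_of_nonneg_right (Δ.abs_le_rayNorm φ i) (hc i)
    _ = Δ.rayNorm φ * ∑ i ∈ σ.1, c i := by rw [Finset.mul_sum]
    _ ≤ _ := mul_le_mul_of_nonneg_left (by linarith) (Δ.rayNorm_nonneg φ)

/-! ### Dyadic boxes -/

/-- The dyadic box of a tuple of positive integers. -/
def dyadic (X : Fin n → ℕ) : Fin n → ℕ := fun i => Nat.log 2 (X i)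

theorem dyadic_le_logb (X : Fin n → ℕ) (i : Fin n) : (dyadic X i : ℝ) ≤ Real.logb 2 (X i) := by
  simpa [dyadic] using Real.natLog_le_logb (X i) 2

theorem logb_le_dyadic (X : Fin n → ℕ) (i : Fin n) :
    Real.logb 2 (X i) ≤ (dyadic X i : ℝ) + 1 := by
  have h : Real.logb 2 (X i) ≤ (Nat.log 2 (X i) + 1 : ℕ) := by
    have h1 := Real.natFloor_logb_natCast 2 (X i)
    rw [← h1]
    push_cast
    exact (Nat.lt_floor_add_one _).le
  simpa [dyadic] using h

/-- If every tuple of `S` lies in a dyadic box `k` with `∑ k + t = H` for some `t`, where the number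
of boxes for a given `t` is at most `Q (t + 1) ^ q`, then `S` has `O(Q 2 ^ H)` elements: the boxes
for `t` have `2 ^ (H - t)` elements. -/
theorem ncard_le_of_dyadic (S : Set (Fin n → ℕ)) (H q : ℕ) (K : ℕ → Finset (Fin n → ℕ)) (Q : ℝ)
    (hpos : ∀ X ∈ S, ∀ i, 0 < X i)
    (hS : ∀ X ∈ S, ∃ t, dyadic X ∈ K t)
    (hK : ∀ t, ∀ k ∈ K t, ∑ i, k i + t = H)
    (hcard : ∀ t, ((K t).card : ℝ) ≤ Q * ((t : ℝ) + 1) ^ q) (hQ : 0 ≤ Q) :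
    S.Finite ∧ (S.ncard : ℝ) ≤
      (∑' t : ℕ, ((t : ℝ) + 1) ^ q * (1 / 2) ^ t) * (Q * 2 ^ H) := by
  classical
  set box : (Fin n → ℕ) → Finset (Fin n → ℕ) := fun k =>
    Fintype.piFinset fun i => Finset.Ico (2 ^ k i) (2 ^ (k i + 1)) with hbox
  have hboxcard : ∀ k, (box k).card = 2 ^ ∑ i, k i := by
    intro k
    rw [hbox, Fintype.card_piFinset, ← Finset.prod_pow_eq_pow_sum]
    refine Finset.prod_congr rfl fun i _ => ?_
    rw [Nat.card_Ico, pow_succ]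
    omega
  set U : Finset (Fin n → ℕ) := (Finset.range (H + 1)).biUnion fun t => (K t).biUnion box with hU
  have hSU : S ⊆ U := by
    intro X hX
    obtain ⟨t, ht⟩ := hS X hX
    simp only [hU, Finset.coe_biUnion, Set.mem_iUnion, Finset.mem_coe]
    refine ⟨t, Finset.mem_range.2 (by have := hK t _ ht; omega), _, ht, ?_⟩
    rw [hbox, Fintype.mem_piFinset]
    intro i
    rw [Finset.mem_Ico]
    exact ⟨Nat.pow_log_le_self 2 (hpos X hX i).ne', Nat.lt_pow_succ_log_self (by norm_num) _⟩
  have hsummable : Summable fun t : ℕ => ((t : ℝ) + 1) ^ q * (1 / 2) ^ t := by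
    have h := summable_pow_mul_geometric_of_norm_lt_one (R := ℝ) q (r := 1 / 2)
      (by rw [Real.norm_eq_abs, abs_of_pos] <;> norm_num)
    have h1 := ((summable_nat_add_iff 1).2 h).mul_left 2
    refine h1.congr fun t => ?_
    push_cast
    rw [pow_succ]
    ring
  refine ⟨U.finite_toSet.subset hSU, ?_⟩
  have h1 : S.ncard ≤ U.card := by
    rw [← Set.ncard_coe_finset]
    exact Set.ncard_le_ncard hSU U.finite_toSet
  have h2 : U.card ≤ ∑ t ∈ Finset.range (H + 1), (K t).card * 2 ^ (H - t) := by
    refine Finset.card_biUnion_le.trans (Finset.sum_le_sum fun t _ => ?_)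
    refine Finset.card_biUnion_le_card_mul _ _ _ fun k hk => ?_
    rw [hboxcard, show ∑ i, k i = H - t by have := hK t k hk; omega]
  calc (S.ncard : ℝ) ≤ ∑ t ∈ Finset.range (H + 1), ((K t).card : ℝ) * 2 ^ (H - t) := by
        exact_mod_cast h1.trans h2
    _ ≤ ∑ t ∈ Finset.range (H + 1), (((t : ℝ) + 1) ^ q * (1 / 2) ^ t) * (Q * 2 ^ H) := by
        refine Finset.sum_le_sum fun t ht => ?_
        have h3 : (2 : ℝ) ^ (H - t) = (1 / 2) ^ t * 2 ^ H := by
          have : t ≤ H := by simpa [Nat.lt_succ_iff] using ht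
          rw [pow_sub₀ _ (by norm_num) this, one_div, inv_pow]
          ring
        rw [h3]
        calc ((K t).card : ℝ) * ((1 / 2) ^ t * 2 ^ H)
            ≤ Q * ((t : ℝ) + 1) ^ q * ((1 / 2) ^ t * 2 ^ H) :=
              mul_le_mul_of_nonneg_right (hcard t) (by positivity)
          _ = _ := by ring
    _ = (∑ t ∈ Finset.range (H + 1), ((t : ℝ) + 1) ^ q * (1 / 2) ^ t) * (Q * 2 ^ H) := by
        rw [Finset.sum_mul]
    _ ≤ _ := mul_le_mul_of_nonneg_right
        (hsummable.sum_le_tsum _ fun t _ => by positivity) (by positivity)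

/-! ### Counting dyadic boxes -/

/-- The dyadic boxes `k` with `∑ k = H - t` for which all coordinates of the lattice point
`∑ k_ϱ n_ϱ` are bounded by `m` and `k_j` is bounded by `p`. -/
def boxes (Δ : CompleteRegularFan d n) (j : Fin n) (H t m p : ℕ) : Finset (Fin n → ℕ) :=
  {k ∈ Fintype.piFinset fun _ => Finset.range (H + 1) |
    ∑ i, k i + t = H ∧ (∀ a, |∑ i, (k i : ℤ) * Δ.gen i a| ≤ m) ∧ k j ≤ p}

theorem mem_boxes {j : Fin n} {H t m p : ℕ} {k : Fin n → ℕ} :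
    k ∈ Δ.boxes j H t m p ↔
      ∑ i, k i + t = H ∧ (∀ a, |∑ i, (k i : ℤ) * Δ.gen i a| ≤ m) ∧ k j ≤ p := by
  rw [boxes, Finset.mem_filter, Fintype.mem_piFinset, and_iff_right_iff_imp]
  rintro ⟨h, -⟩ i
  have := Finset.single_le_sum (f := k) (fun _ _ => Nat.zero_le _) (Finset.mem_univ i)
  rw [Finset.mem_range]
  omega

theorem card_boxes_le_pow (Δ : CompleteRegularFan d n) (j : Fin n) (H t m p : ℕ) :
    (Δ.boxes j H t m p).card ≤ (H + 1) ^ n := by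
  refine (Finset.card_filter_le _ _).trans ?_
  simp [Fintype.card_piFinset]

/-- Character values on an integral combination of the rays, through its coordinates. -/
theorem sum_mul_apply_gen (φ : M d) (z : Fin n → ℤ) :
    ∑ i, z i * φ (Δ.gen i) = ∑ a, (∑ i, z i * Δ.gen i a) * φ (Pi.single a 1) := by
  simp_rw [Finset.sum_mul]
  rw [Finset.sum_comm]
  refine Finset.sum_congr rfl fun i _ => ?_
  rw [dual_apply_eq_sum φ (Δ.gen i), Finset.mul_sum]
  exact Finset.sum_congr rfl fun a _ => by ring

/-- If `D_0(σ)` is nonzero at a ray `i` outside `σ(1) ∪ {j}`, then a box `k` is determined by its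
entries outside `σ(1) ∪ {i, j}`, together with `k_j`, `∑ k` and the lattice point `∑ k_ϱ n_ϱ`. -/
theorem card_boxes_le (σ : Δ.MaxCone) {i j : Fin n} (hi : i ∉ σ.1) (hj : j ∉ σ.1) (hij : i ≠ j)
    (hm : σ.m (Δ.gen i) ≠ 1) (H t m p : ℕ) :
    d + 2 ≤ n ∧
    (Δ.boxes j H t m p).card ≤ (H + 1) ^ (n - d - 2) * ((2 * m + 1) ^ d * (p + 1)) := by
  classical
  set J : Finset (Fin n) := insert i (insert j σ.1) with hJ
  have hJcard : J.card = d + 2 := by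
    rw [hJ, Finset.card_insert_of_notMem, Finset.card_insert_of_notMem hj, σ.2.2]
    simp [hi, hij]
  have hJn : d + 2 ≤ n := by
    rw [← hJcard]
    simpa using Finset.card_le_univ J
  refine ⟨hJn, ?_⟩
  set f : (Fin n → ℕ) → (Fin n → ℕ) × (Fin d → ℤ) × ℕ := fun k =>
    (fun l => if l ∈ J then 0 else k l, fun a => ∑ i, (k i : ℤ) * Δ.gen i a, k j) with hf
  set target : Finset ((Fin n → ℕ) × (Fin d → ℤ) × ℕ) :=
    (Fintype.piFinset fun l => if l ∈ J then {0} else Finset.range (H + 1)) ×ˢ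
      (Fintype.piFinset fun _ => Finset.Icc (-(m : ℤ)) m) ×ˢ Finset.range (p + 1) with htarget
  have hcard : target.card = (H + 1) ^ (n - d - 2) * ((2 * m + 1) ^ d * (p + 1)) := by
    rw [htarget, Finset.card_product, Finset.card_product, Fintype.card_piFinset,
      Fintype.card_piFinset]
    congr 1
    · have h1 : ∀ l, (if l ∈ J then ({0} : Finset ℕ) else Finset.range (H + 1)).card =
          if l ∈ J then 1 else H + 1 := by
        intro l
        split_ifs <;> simp
      simp_rw [h1]
      rw [Finset.prod_ite, Finset.prod_const_one, Finset.prod_const, one_mul]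
      congr 1
      have h2 : (Finset.univ.filter fun l => l ∉ J) = Jᶜ := by ext; simp
      rw [h2, Finset.card_compl, hJcard, Fintype.card_fin]
      omega
    · congr 1
      · simp only [Int.card_Icc, Finset.prod_const, Finset.card_univ, Fintype.card_fin]
        congr 1
        omega
      · simp
  rw [← hcard]
  refine Finset.card_le_card_of_injOn f ?_ ?_
  · intro k hk
    have hk' := hk
    rw [Finset.mem_coe, boxes, Finset.mem_filter, Fintype.mem_piFinset] at hk'
    obtain ⟨h1, -, h2, h3⟩ := hk'
    simp only [htarget, hf, Finset.coe_product, Set.mem_prod, Finset.mem_coe,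
      Fintype.mem_piFinset, Finset.mem_Icc, Finset.mem_range]
    refine ⟨fun l => ?_, fun a => abs_le.1 (h2 a), by omega⟩
    by_cases hl : l ∈ J
    · simp [hl]
    · simpa [hl] using h1 l
  · intro k hk k' hk' hkk
    rw [Finset.mem_coe, mem_boxes] at hk hk'
    simp only [hf, Prod.mk.injEq] at hkk
    obtain ⟨h1, h2, h3⟩ := hkk
    set z : Fin n → ℤ := fun l => (k l : ℤ) - k' l with hz
    have hout : ∀ l, l ∉ J → z l = 0 := by
      intro l hl
      have := congrFun h1 l
      simp only [hl, if_false] at this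
      simp [hz, this]
    have hzj : z j = 0 := by simp [hz, h3]
    have hzy : ∀ a, ∑ l, z l * Δ.gen l a = 0 := by
      intro a
      have := congrFun h2 a
      simp only [hz, sub_mul, Finset.sum_sub_distrib]
      rw [this, sub_self]
    have hzsum : ∑ l, z l = 0 := by
      simp only [hz, Finset.sum_sub_distrib]
      have h4 : ∑ l, k l = ∑ l, k' l := by have := hk.1; have := hk'.1; omega
      have h5 : (∑ l, (k l : ℤ)) = ∑ l, (k' l : ℤ) := by exact_mod_cast h4
      rw [h5, sub_self]
    have hφ : ∀ φ : M d, ∑ l, z l * φ (Δ.gen l) = 0 := by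
      intro φ
      rw [sum_mul_apply_gen]
      simp [hzy]
    have hzi : z i = 0 := by
      -- the coefficients of `D_0(σ)` vanish on `σ(1)`, so only the one at `i` contributes
      have h6 : ∑ l, z l * (1 - σ.m (Δ.gen l)) = 0 := by
        simp only [mul_sub, mul_one, Finset.sum_sub_distrib, hzsum, hφ, sub_self]
      rw [Finset.sum_eq_single i] at h6
      · rcases mul_eq_zero.1 h6 with h | h
        · exact h
        · exact absurd (by linarith) hm
      · intro l _ hl
        by_cases hlσ : l ∈ σ.1
        · simp [σ.m_gen hlσ]
        · by_cases hlj : l = j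
          · simp [hlj, hzj]
          · rw [hout l (by simp [hJ, hl, hlj, hlσ]), zero_mul]
      · simp
    have hzσ : ∀ l, l ∉ σ.1 → z l = 0 := by
      intro l hl
      by_cases hlj : l = j
      · rw [hlj, hzj]
      by_cases hli : l = i
      · rw [hli, hzi]
      exact hout l (by simp [hJ, hl, hlj, hli])
    funext l
    suffices h : z l = 0 by
      simp only [hz] at h
      omega
    by_cases hl : l ∈ σ.1
    · have h7 := hφ (σ.dualVec ⟨l, hl⟩)
      rw [Finset.sum_eq_single l] at h7
      · simpa [σ.dualVec_gen ⟨l, hl⟩ ⟨l, hl⟩] using h7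
      · intro l' _ hl'
        by_cases hl'σ : l' ∈ σ.1
        · rw [σ.dualVec_gen ⟨l', hl'σ⟩ ⟨l, hl⟩, if_neg (by simpa using hl'), mul_zero]
        · rw [hzσ l' hl'σ, zero_mul]
      · simp
    · exact hzσ l hl

/-- If `D_0(σ)` is a multiple of `D_j`, then `∑ k` is a combination of `k_j` and the coordinates
of `∑ k_ϱ n_ϱ`, so `H` is small whenever there is a box at all. -/
theorem le_of_mem_boxes (σ : Δ.MaxCone) {j : Fin n}
    (hm : ∀ i, i ∉ σ.1 → i ≠ j → σ.m (Δ.gen i) = 1) :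
    ∃ c : ℕ, ∀ (H t m p : ℕ) (k : Fin n → ℕ), k ∈ Δ.boxes j H t m p → H ≤ c * (t + m + p) := by
  classical
  set c₁ : ℤ := ∑ a, |σ.m (Pi.single a 1)| with hc₁
  set c₂ : ℤ := |1 - σ.m (Δ.gen j)| with hc₂
  have hc₁0 : 0 ≤ c₁ := Finset.sum_nonneg fun _ _ => abs_nonneg _
  have hc₂0 : 0 ≤ c₂ := abs_nonneg _
  refine ⟨(1 + c₁ + c₂).toNat, fun H t m p k hk => ?_⟩
  obtain ⟨h1, h2, h3⟩ := mem_boxes.1 hk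
  have h4 : (∑ i, (k i : ℤ)) = ∑ i, (k i : ℤ) * σ.m (Δ.gen i) + k j * (1 - σ.m (Δ.gen j)) := by
    have h5 : ∑ i, (k i : ℤ) * (1 - σ.m (Δ.gen i)) = k j * (1 - σ.m (Δ.gen j)) := by
      refine Finset.sum_eq_single j (fun i _ hij => ?_) (by simp)
      by_cases hi : i ∈ σ.1
      · simp [σ.m_gen hi]
      · simp [hm i hi hij]
    rw [← h5, ← Finset.sum_add_distrib]
    exact Finset.sum_congr rfl fun i _ => by ring
  have h6 : ∑ i, (k i : ℤ) * σ.m (Δ.gen i) ≤ m * c₁ := by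
    rw [sum_mul_apply_gen, hc₁, Finset.mul_sum]
    refine Finset.sum_le_sum fun a _ => (le_abs_self _).trans ?_
    rw [abs_mul]
    exact mul_le_mul_of_nonneg_right (h2 a) (abs_nonneg _)
  have h7 : (k j : ℤ) * (1 - σ.m (Δ.gen j)) ≤ p * c₂ := by
    refine (mul_le_mul_of_nonneg_left (le_abs_self _) (by positivity)).trans ?_
    exact mul_le_mul_of_nonneg_right (by exact_mod_cast h3) hc₂0
  have h8 : (∑ i, (k i : ℤ)) + t = H := by exact_mod_cast h1
  zify
  rw [Int.toNat_of_nonneg (by positivity)]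
  have h9 : 0 ≤ (t : ℤ) * (c₁ + c₂) + m * (1 + c₂) + p * (1 + c₁) := by positivity
  linarith

/-! ### The boxes of the points with a small monomial -/

theorem one_lt_log {B : ℝ} (hB : 3 ≤ B) : 1 < Real.log B := by
  rw [Real.lt_log_iff_exp_lt (by linarith)]
  linarith [Real.exp_one_lt_d9]

/-- Points of height at most `B` with `X^{E_σ(j)}` below `(log B)^A` have a dyadic box for which
`k_j` is small and `∑ k_ϱ n_ϱ` is close to zero, up to the defect `t` of `∑ k` from `log₂ B`. -/
theorem exists_dyadic_mem_boxes (σ : Δ.MaxCone) (j : σ.1) (A : ℝ) :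
    ∃ R : ℕ, ∀ B : ℝ, 3 ≤ B → ∀ X ∈ Δ.setA B, monomial X (σ.E j) < Real.log B ^ A →
      ∃ t : ℕ, dyadic X ∈ Δ.boxes j ⌊Real.logb 2 B⌋₊ t (R * (t + 1))
        ⌊R * (Real.log (Real.log B) + (t + 1))⌋₊ := by
  obtain ⟨R, hR⟩ := exists_nat_ge
    (|A / Real.log 2| + Δ.rayNorm (σ.dualVec j) +
      2 * ∑ a : Fin d, Δ.rayNorm (LinearMap.proj a))
  have hproj0 : 0 ≤ ∑ a : Fin d, Δ.rayNorm (LinearMap.proj a) :=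
    Finset.sum_nonneg fun a _ => Δ.rayNorm_nonneg _
  have hdual0 := Δ.rayNorm_nonneg (σ.dualVec j)
  have hRA : A / Real.log 2 ≤ R := by
    have := le_abs_self (A / Real.log 2)
    linarith
  have hRdual : Δ.rayNorm (σ.dualVec j) ≤ R := by
    have := abs_nonneg (A / Real.log 2)
    linarith
  have hRproj : ∀ a : Fin d, 2 * Δ.rayNorm (LinearMap.proj a) ≤ R := by
    intro a
    have h1 := Finset.single_le_sum (f := fun a : Fin d => Δ.rayNorm (LinearMap.proj a))
      (fun a _ => Δ.rayNorm_nonneg _) (Finset.mem_univ a)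
    have := abs_nonneg (A / Real.log 2)
    linarith
  refine ⟨R, fun B hB X hX hE => ?_⟩
  have hlogB : 1 < Real.log B := one_lt_log hB
  have hℓ : 0 < Real.log (Real.log B) := Real.log_pos hlogB
  obtain ⟨hsum, hφ⟩ := abs_sum_logb_le hX
  have hL := Nat.lt_floor_add_one (Real.logb 2 B)
  set H := ⌊Real.logb 2 B⌋₊
  set k := dyadic X
  have hkx : ∀ i, (k i : ℝ) ≤ Real.logb 2 (X i) := dyadic_le_logb X
  have hxk : ∀ i, Real.logb 2 (X i) ≤ k i + 1 := logb_le_dyadic X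
  have hkx_sum : ((∑ i, k i : ℕ) : ℝ) ≤ ∑ i, Real.logb 2 (X i) := by
    push_cast
    exact Finset.sum_le_sum fun i _ => hkx i
  have hkH : ∑ i, k i ≤ H := Nat.le_floor (hkx_sum.trans hsum)
  obtain ⟨t, ht⟩ := Nat.exists_eq_add_of_le hkH
  have ht' : (H : ℝ) = (∑ i, k i : ℕ) + t := by exact_mod_cast ht
  have hgap : Real.logb 2 B - ∑ i, Real.logb 2 (X i) ≤ t + 1 := by linarith
  have hφ' : ∀ φ : M d, |∑ i, Real.logb 2 (X i) * (φ (Δ.gen i) : ℝ)| ≤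
      Δ.rayNorm φ * (t + 1) := fun φ =>
    (hφ φ).trans (mul_le_mul_of_nonneg_left hgap (Δ.rayNorm_nonneg φ))
  refine ⟨t, mem_boxes.2 ⟨ht.symm, fun a => ?_, ?_⟩⟩
  · have h1 := hφ' (LinearMap.proj a)
    have h2 : |∑ i, (Real.logb 2 (X i) - k i) * ((LinearMap.proj a : M d) (Δ.gen i) : ℝ)| ≤
        Δ.rayNorm (LinearMap.proj a) := by
      refine (Finset.abs_sum_le_sum_abs _ _).trans (Finset.sum_le_sum fun i _ => ?_)
      rw [abs_mul]
      refine mul_le_of_le_one_left (abs_nonneg _) ?_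
      rw [abs_of_nonneg (by linarith [hkx i])]
      linarith [hxk i]
    have h3 : ∑ i, (k i : ℝ) * (Δ.gen i a : ℝ) =
        ∑ i, Real.logb 2 (X i) * ((LinearMap.proj a : M d) (Δ.gen i) : ℝ) -
          ∑ i, (Real.logb 2 (X i) - k i) * ((LinearMap.proj a : M d) (Δ.gen i) : ℝ) := by
      rw [← Finset.sum_sub_distrib]
      refine Finset.sum_congr rfl fun i _ => ?_
      rw [LinearMap.proj_apply]
      ring
    have h4 : |∑ i, (k i : ℝ) * (Δ.gen i a : ℝ)| ≤ R * (t + 1) := by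
      rw [h3]
      refine (abs_sub _ _).trans ?_
      have h5 := mul_le_mul_of_nonneg_right (hRproj a) (by positivity : (0 : ℝ) ≤ t + 1)
      have h6 : 0 ≤ Δ.rayNorm (LinearMap.proj a) * (t : ℝ) :=
        mul_nonneg (Δ.rayNorm_nonneg _) (by positivity)
      linarith
    exact_mod_cast h4
  · refine Nat.le_floor ?_
    have h1 : Real.logb 2 (monomial X (σ.E j)) < Real.logb 2 (Real.log B ^ A) :=
      Real.logb_lt_logb (by norm_num) (monomial_pos hX.1 _) hE
    have h2 : Real.logb 2 (monomial X (σ.E j)) = Real.logb 2 (X j) -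
        ∑ i, Real.logb 2 (X i) * (σ.dualVec j (Δ.gen i) : ℝ) := by
      rw [logb_monomial hX.1]
      simp only [MaxCone.E, MaxCone.F, divHom, Pi.sub_apply, LinearMap.pi_apply,
        Module.Dual.eval_apply, Int.cast_sub, sub_mul, Finset.sum_sub_distrib]
      congr 1
      · rw [Finset.sum_eq_single (j : Fin n)]
        · simp
        · intro i _ hij
          simp [hij]
        · simp
      · exact Finset.sum_congr rfl fun i _ => mul_comm _ _
    have h3 : Real.logb 2 (Real.log B ^ A) = A / Real.log 2 * Real.log (Real.log B) := by
      rw [Real.logb, Real.log_rpow (by linarith)]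
      ring
    have h4 := (le_abs_self _).trans (hφ' (σ.dualVec j))
    have h5 := mul_le_mul_of_nonneg_right hRdual (by positivity : (0 : ℝ) ≤ t + 1)
    have h6 := mul_le_mul_of_nonneg_right hRA hℓ.le
    have h7 := hkx j
    rw [h2, h3] at h1
    linarith

/-! ### Summation over the boxes -/

theorem add_le_mul_mul {ℓ ℓ₀ s : ℝ} (h₀ : 0 < ℓ₀) (hℓ : ℓ₀ ≤ ℓ) (hs : 1 ≤ s) :
    ℓ + s ≤ (1 + 1 / ℓ₀) * (ℓ * s) := by
  have h1 : ℓ ≤ ℓ * s := le_mul_of_one_le_right (h₀.le.trans hℓ) hs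
  have h2 : s ≤ 1 / ℓ₀ * (ℓ * s) := by
    rw [← mul_assoc]
    refine le_mul_of_one_le_left (by linarith) ?_
    rw [one_div, inv_mul_eq_div, le_div_iff₀ h₀]
    linarith
  linarith

/-- Uniform bound for the number of boxes, with `L = log B` and `ℓ = log log B`. -/
theorem card_boxes_le_log (Δ : CompleteRegularFan d n) (j : Fin n) (R : ℕ) {ℓ₀ c : ℝ}
    (h₀ : 0 < ℓ₀) (hc : 0 ≤ c) :
    ∃ C : ℝ, 0 ≤ C ∧ ∀ (L ℓ : ℝ) (H t : ℕ), ℓ₀ ≤ ℓ → L = Real.exp ℓ → L ≤ H + 1 →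
      (H : ℝ) + 1 ≤ c * L →
      ((Δ.boxes j H t (R * (t + 1)) ⌊R * (ℓ + (t + 1))⌋₊).card : ℝ) ≤
        C * (L ^ ((Δ.picRank : ℤ) - 2) * ℓ) * ((t : ℝ) + 1) ^ (d + 3) := by
  obtain ⟨σ, hj⟩ := Δ.exists_maxCone_notMem j
  have hr := Δ.picRank_add
  by_cases hdep : ∃ i, i ∉ σ.1 ∧ i ≠ j ∧ σ.m (Δ.gen i) ≠ 1
  · obtain ⟨i, hi, hij, hm⟩ := hdep
    refine ⟨c ^ (n - d - 2) * (2 * R + 1) ^ d * ((R + 1) * (1 + 1 / ℓ₀)), by positivity, ?_⟩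
    intro L ℓ H t hℓ hL _ hHc
    obtain ⟨hdn, hcard⟩ := card_boxes_le σ hi hj hij hm H t (R * (t + 1)) ⌊R * (ℓ + (t + 1))⌋₊
    have hℓ0 : 0 < ℓ := h₀.trans_le hℓ
    have hL0 : 0 < L := hL ▸ Real.exp_pos ℓ
    set s : ℝ := (t : ℝ) + 1 with hs
    have hs1 : 1 ≤ s := by rw [hs]; linarith [(Nat.cast_nonneg t : (0 : ℝ) ≤ t)]
    have hs0 : 0 < s := by linarith
    set p := ⌊R * (ℓ + s)⌋₊
    have h1 : L ^ ((Δ.picRank : ℤ) - 2) = L ^ (n - d - 2) := by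
      rw [← zpow_natCast]
      congr 1
      omega
    have h2 : (p : ℝ) + 1 ≤ (R + 1) * (1 + 1 / ℓ₀) * (ℓ * s) := by
      have h3 : (p : ℝ) ≤ R * (ℓ + s) := Nat.floor_le (by positivity)
      have h4 := mul_le_mul_of_nonneg_left (add_le_mul_mul h₀ hℓ hs1)
        (by positivity : (0 : ℝ) ≤ R + 1)
      linarith
    have h5 : 2 * (R * s) + 1 ≤ (2 * R + 1) * s := by linarith
    calc ((Δ.boxes j H t (R * (t + 1)) p).card : ℝ)
        ≤ ((H : ℝ) + 1) ^ (n - d - 2) *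
          ((2 * (R * s) + 1) ^ d * ((p : ℝ) + 1)) := by
          rw [hs]
          exact_mod_cast hcard
      _ ≤ (c * L) ^ (n - d - 2) *
          (((2 * R + 1) * s) ^ d * ((R + 1) * (1 + 1 / ℓ₀) * (ℓ * s))) := by gcongr
      _ = c ^ (n - d - 2) * (2 * R + 1) ^ d * ((R + 1) * (1 + 1 / ℓ₀)) *
          (L ^ (n - d - 2) * ℓ) * s ^ (d + 1) := by
          rw [mul_pow, mul_pow]
          ring
      _ ≤ _ := by
          rw [h1]
          exact mul_le_mul_of_nonneg_left (pow_le_pow_right₀ hs1 (by omega)) (by positivity)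
  · have hm : ∀ i, i ∉ σ.1 → i ≠ j → σ.m (Δ.gen i) = 1 := by
      intro i hi hij
      by_contra h
      exact hdep ⟨i, hi, hij, h⟩
    obtain ⟨c', hc'⟩ := le_of_mem_boxes σ hm
    set c₂ : ℝ := (1 + c' * (2 * R + 1)) * (1 + 1 / ℓ₀) with hc₂
    refine ⟨c ^ n * c₂ ^ (d + 3) * (d + 2).factorial, by positivity, ?_⟩
    intro L ℓ H t hℓ hL hLH hHc
    have hℓ0 : 0 < ℓ := h₀.trans_le hℓ
    have hL0 : 0 < L := hL ▸ Real.exp_pos ℓ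
    set s : ℝ := (t : ℝ) + 1 with hs
    have hs1 : 1 ≤ s := by rw [hs]; linarith [(Nat.cast_nonneg t : (0 : ℝ) ≤ t)]
    have hs0 : 0 < s := by linarith
    set p := ⌊R * (ℓ + s)⌋₊
    rcases (Δ.boxes j H t (R * (t + 1)) p).eq_empty_or_nonempty with he | ⟨k, hk⟩
    · rw [he]
      simp only [Finset.card_empty, Nat.cast_zero]
      positivity
    have h1 : (H : ℝ) ≤ c' * (t + R * s + p) := by
      rw [hs]
      exact_mod_cast hc' _ _ _ _ k hk
    have h2 : (p : ℝ) ≤ R * (ℓ + s) := Nat.floor_le (by positivity)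
    have h3 : L ≤ c₂ * (ℓ * s) := by
      have h4 : (t : ℝ) + R * s + p ≤ (2 * R + 1) * (ℓ + s) := by
        have : 0 ≤ (R : ℝ) * ℓ := by positivity
        linarith
      have h5 := mul_le_mul_of_nonneg_left h4 (Nat.cast_nonneg c' : (0 : ℝ) ≤ c')
      have h6 := mul_le_mul_of_nonneg_left (add_le_mul_mul h₀ hℓ hs1)
        (by positivity : (0 : ℝ) ≤ 1 + c' * (2 * R + 1))
      linarith
    -- a factor at least one, which saves as many powers of `L` as needed
    have h7 : 1 ≤ (c₂ * (ℓ * s) / L) ^ (d + 3) := one_le_pow₀ ((one_le_div hL0).2 h3)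
    have h8 : ℓ ^ (d + 2) ≤ (d + 2).factorial * L := by
      have := Real.pow_div_factorial_le_exp ℓ hℓ0.le (d + 2)
      rwa [← hL, div_le_iff₀ (by positivity), mul_comm] at this
    have h9 : L ^ n * L / L ^ (d + 3) = L ^ ((Δ.picRank : ℤ) - 2) := by
      rw [← pow_succ, ← zpow_natCast, ← zpow_natCast, ← zpow_sub₀ hL0.ne']
      congr 1
      push_cast
      omega
    calc ((Δ.boxes j H t (R * (t + 1)) p).card : ℝ) ≤ ((H : ℝ) + 1) ^ n := by
          exact_mod_cast Δ.card_boxes_le_pow j H t (R * (t + 1)) p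
      _ ≤ (c * L) ^ n := by gcongr
      _ ≤ (c * L) ^ n * (c₂ * (ℓ * s) / L) ^ (d + 3) :=
          le_mul_of_one_le_right (by positivity) h7
      _ = c ^ n * c₂ ^ (d + 3) * (L ^ n / L ^ (d + 3)) * (ℓ * s ^ (d + 3)) * ℓ ^ (d + 2) := by
          rw [mul_pow c L, div_pow, mul_pow c₂, mul_pow ℓ s, pow_succ ℓ (d + 2)]
          generalize c₂ ^ (d + 3) = u, L ^ (d + 3) = v, s ^ (d + 3) = w, ℓ ^ (d + 2) = y
          ring
      _ ≤ c ^ n * c₂ ^ (d + 3) * (L ^ n / L ^ (d + 3)) * (ℓ * s ^ (d + 3)) *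
          ((d + 2).factorial * L) := by gcongr
      _ = c ^ n * c₂ ^ (d + 3) * (d + 2).factorial * ((L ^ n * L / L ^ (d + 3)) * ℓ) *
          s ^ (d + 3) := by ring
      _ = _ := by rw [h9]

/-- The points of height at most `B` for which one given monomial `X^{E_σ(j)}` is below
`(log B)^A`. -/
theorem ncard_small_monomial_le (σ : Δ.MaxCone) (j : σ.1) (A : ℝ) :
    ∃ C : ℝ, ∀ B : ℝ, 3 ≤ B →
      {X ∈ Δ.setA B | monomial X (σ.E j) < Real.log B ^ A}.Finite ∧
      ({X ∈ Δ.setA B | monomial X (σ.E j) < Real.log B ^ A}.ncard : ℝ) ≤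
        C * (B * Real.log B ^ ((Δ.picRank : ℤ) - 2) * Real.log (Real.log B)) := by
  obtain ⟨R, hR⟩ := exists_dyadic_mem_boxes σ j A
  have hlog2 : 0 < Real.log 2 := Real.log_pos (by norm_num)
  have h₀ : 0 < Real.log (Real.log 3) := Real.log_pos (one_lt_log le_rfl)
  obtain ⟨C, hC, hbox⟩ := card_boxes_le_log Δ (j : Fin n) R h₀
    (by positivity : 0 ≤ 1 / Real.log 2 + 1)
  set G : ℝ := ∑' t : ℕ, ((t : ℝ) + 1) ^ (d + 3) * (1 / 2) ^ t with hG
  have hG0 : 0 ≤ G := tsum_nonneg fun t => by positivity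
  refine ⟨G * C, fun B hB => ?_⟩
  have hL1 := one_lt_log hB
  have hB0 : 0 < B := by linarith
  set L := Real.log B with hL
  set ℓ := Real.log L with hℓ
  have hℓ0 : 0 < ℓ := Real.log_pos hL1
  have hlogb : Real.logb 2 B = 1 / Real.log 2 * L := by rw [Real.logb]; ring
  have hLb : L ≤ Real.logb 2 B := by
    rw [hlogb]
    refine le_mul_of_one_le_left (by linarith) ?_
    rw [one_le_div hlog2]
    linarith [Real.log_two_lt_d9]
  set H := ⌊Real.logb 2 B⌋₊ with hH
  have hH1 : (H : ℝ) ≤ Real.logb 2 B := Nat.floor_le (by linarith)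
  have hH2 : Real.logb 2 B < H + 1 := Nat.lt_floor_add_one _
  have hcard : ∀ t : ℕ,
      ((Δ.boxes j H t (R * (t + 1)) ⌊R * (ℓ + (t + 1))⌋₊).card : ℝ) ≤
        C * (L ^ ((Δ.picRank : ℤ) - 2) * ℓ) * ((t : ℝ) + 1) ^ (d + 3) := by
    intro t
    refine hbox L ℓ H t ?_ (Real.exp_log (by linarith)).symm (by linarith) (by linarith)
    have h3 := one_lt_log (le_refl 3)
    exact Real.log_le_log (by linarith) (Real.log_le_log (by norm_num) hB)
  have hQ : 0 ≤ C * (L ^ ((Δ.picRank : ℤ) - 2) * ℓ) := by positivity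
  obtain ⟨hfin, hle⟩ := ncard_le_of_dyadic
    {X ∈ Δ.setA B | monomial X (σ.E j) < L ^ A} H (d + 3)
    (fun t => Δ.boxes j H t (R * (t + 1)) ⌊R * (ℓ + (t + 1))⌋₊) _ (fun X hX => hX.1.1)
    (fun X hX => hR B hB X hX.1 hX.2) (fun t k hk => (mem_boxes.1 hk).1) hcard hQ
  refine ⟨hfin, hle.trans ?_⟩
  have h2H : (2 : ℝ) ^ H ≤ B := by
    rw [← Real.rpow_natCast]
    exact (Real.le_logb_iff_rpow_le (by norm_num) hB0).1 hH1
  calc G * (C * (L ^ ((Δ.picRank : ℤ) - 2) * ℓ) * 2 ^ H)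
      ≤ G * (C * (L ^ ((Δ.picRank : ℤ) - 2) * ℓ) * B) := by gcongr
    _ = _ := by ring

end CompleteRegularFan
end ToricCount
end

open ToricCount CompleteRegularFan in
theorem theorem4p1 {d n : ℕ} (Δ : ToricCount.CompleteRegularFan d n)
    (hproj : Δ.Projective)
    (hgg : Δ.GloballyGenerated (ToricCount.CompleteRegularFan.D₀ n))
    (A : ℝ) (hA : 0 < A) :
    ∃ C : ℝ, ∀ B : ℝ, 3 ≤ B →
      (Δ.setA B \ Δ.setAFlat A B).Finite ∧
      ((Δ.setA B \ Δ.setAFlat A B).ncard : ℝ) ≤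
        C * (B * Real.log B ^ ((Δ.picRank : ℤ) - 2) * Real.log (Real.log B)) := by
  classical
  have := Fintype.ofFinite Δ.MaxCone
  choose C hC using fun p : (Σ σ : Δ.MaxCone, σ.1) => ncard_small_monomial_le p.1 p.2 A
  refine ⟨∑ p, C p, fun B hB => ?_⟩
  set S : (Σ σ : Δ.MaxCone, σ.1) → Set (Fin n → ℕ) := fun p =>
    {X ∈ Δ.setA B | monomial X (p.1.E p.2) < Real.log B ^ A} with hS
  have hsub : Δ.setA B \ Δ.setAFlat A B ⊆ ⋃ p, S p := by
    rintro X ⟨hX, hflat⟩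
    by_contra h
    refine hflat ⟨hX, fun σ j => ?_⟩
    by_contra hlt
    exact h (Set.mem_iUnion.2 ⟨⟨σ, j⟩, hX, not_le.1 hlt⟩)
  have hfin : (⋃ p, S p).Finite := Set.finite_iUnion fun p => (hC p B hB).1
  refine ⟨hfin.subset hsub, ?_⟩
  have h1 : (⋃ p, S p).ncard ≤ ∑ p, (S p).ncard := by
    have := Set.ncard_iUnion_le_of_fintype S
    simpa using this
  calc ((Δ.setA B \ Δ.setAFlat A B).ncard : ℝ) ≤ ∑ p, ((S p).ncard : ℝ) := by
        exact_mod_cast (Set.ncard_le_ncard hsub hfin).trans h1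
    _ ≤ _ := by
        rw [Finset.sum_mul]
        exact Finset.sum_le_sum fun p _ => (hC p B hB).2
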